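/- For an integer $n \ge 1$ let $\mathcal{E}_{\mathbb{Z}_n}$ denote the essential ideal graph of the ring $\mathbb{Z}_n$: its vertices are the nonzero proper ideals of $\mathbb{Z}_n$, and two distinct vertices $I, K$ are adjacent if and only if $I+K$ is an essential ideal, i.e. an ideal having nonzero intersection with every nonzero ideal. For a finite graph $\Gamma$ on at least two vertices let $a(\Gamma)$ (the algebraic connectivity) be the second smallest eigenvalue, counted with multiplicity, of the Laplacian matrix of $\Gamma$, and let $\kappa(\Gamma)$ (the vertex connectivity) be the minimum number of vertices whose removal disconnects $\Gamma$, with $\kappa(K_N) = N-1$ for the complete graph on $N$ vertices. 1. If $n = p_1 p_2 \cdots p_k$ is a product of $k > 2$ distinct primes, then $a(\mathcal{E}_{\mathbb{Z}_n}) < \kappa(\mathcal{E}_{\mathbb{Z}_n})$. 2. If $n = p_1^{m_1} p_2^{m_2}$ with $p_1 \ne p_2$ primes, $m_1, m_2 \ge 1$, and $m_i > 1$ for at least one $i \in \{1,2\}$, then $$a(\mathcal{E}_{\mathbb{Z}_n}) = \kappa(\mathcal{E}_{\mathbb{Z}_n}) = T - \max\{m_1, m_2\},$$ where $T = (m_1+1)(m_2+1)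 - 2$ is the number of vertices of $\mathcal{E}_{\mathbb{Z}_n}$. -/

import Mathlib

/-- An ideal is essential if it meets every nonzero ideal nontrivially. -/
def IsEssentialIdeal {R : Type*} [CommRing R] (I : Ideal R) : Prop :=
  ∀ K : Ideal R, K ≠ ⊥ → I ⊓ K ≠ ⊥

/-- The nonzero proper ideals of a commutative ring. -/
abbrev NonzeroProperIdeal (R : Type*) [CommRing R] : Type _ :=
  {I : Ideal R // I ≠ ⊥ ∧ I ≠ ⊤}

/-- The essential ideal graph: its vertices are the nonzero proper ideals, and two distinct
vertices `I`, `K` are adjacent if and only if `I + K` is an essential ideal. -/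
def essentialIdealGraph (R : Type*) [CommRing R] : SimpleGraph (NonzeroProperIdeal R) where
  Adj I K := I ≠ K ∧ IsEssentialIdeal (I.1 + K.1)
  symm := ⟨fun I K h => ⟨h.1.symm, by rw [add_comm]; exact h.2⟩⟩
  loopless := ⟨fun _ h => h.1 rfl⟩

/-- The algebraic connectivity of a finite graph: the second smallest eigenvalue, counted with
multiplicity, of its Laplacian matrix. Here `eigenvalues₀` lists the eigenvalues in decreasing
order, so with `N` vertices (indices `0, …, N - 1`) it is the entry with index `N - 2`.
By convention the value is `0` if there are fewer than two vertices. -/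
noncomputable def algebraicConnectivity {V : Type*} [Finite V] (G : SimpleGraph V) : ℝ := by
  classical
  letI : Fintype V := Fintype.ofFinite V
  exact
    if h : 2 ≤ Fintype.card V then
      (G.isHermitian_lapMatrix (R := ℝ)).eigenvalues₀ ⟨Fintype.card V - 2, by omega⟩
    else 0

open scoped Classical in
/-- The vertex connectivity of a finite graph: the minimum number of vertices whose removal
leaves a disconnected graph; for a complete graph on `N` vertices it is `N - 1`. -/
noncomputable def vertexConnectivity {V : Type*} [Finite V] (G : SimpleGraph V) : ℕ :=
  if G = ⊤ then Nat.card V - 1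
  else sInf {c : ℕ | ∃ S : Finset V,
    S.card = c ∧ ¬ (G.induce ((S : Set V)ᶜ)).Preconnected}

/-!
The ideals of `ZMod n` correspond to the divisors of `n` (`idealDivisor`): inclusion is reversed
divisibility, sums are greatest common divisors and intersections are least common multiples. An
ideal is essential exactly if it contains every minimal ideal, that is, if its divisor divides
`n / p` for every prime `p ∣ n` (`isEssentialIdeal_iff_dvd_div`).

For squarefree `n` this makes two vertices adjacent exactly if their divisors are coprime. For a
prime `p ∣ n` the vertex `n / p` is then pendant with neighbour `p`, and if `n` has a third prime
factor, then `p` is not adjacent to `p * q`. The graph is connected, so its vertex connectivity is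
at least `1`. A test function that vanishes at `p`, is `-1` at the vertices other than `p` and
`n / p`, and has sum zero, shows that the algebraic connectivity is less than `1`
(`algebraicConnectivity_lt_one_of_pendant`).

For `n = p ^ a * q ^ b` two vertices are nonadjacent exactly if both divisors are multiples of
`p ^ a`, or both are multiples of `q ^ b`, or they coincide. So the graph is complete multipartite
with parts of sizes `b`, `a`, `1`, …, `1`. For a complete multipartite graph on `N` vertices whose
largest part has `M ≥ 2` vertices, the two connectivities are both `N - M`: a set of remaining
vertices is disconnected only inside a single part, and on functions with sum zero the Laplacian
form is `∑ i, (N - dᵢ) xᵢ²` plus the sum of the squared part sums, where `dᵢ` is the size of the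
part of `i` (`dirichletEnergy_of_adj_iff_ne`).

The algebraic connectivity is estimated through its variational characterization as the minimum of
the Laplacian form over unit vectors with sum zero, whose two halves are
`le_algebraicConnectivity` and `algebraicConnectivity_mul_le`.
-/

/-! ### The second smallest eigenvalue of a symmetric matrix -/

open Matrix in
/-- The quadratic form of a real symmetric matrix, written in an orthonormal eigenbasis. -/
lemma Matrix.IsHermitian.dotProduct_mulVec_eq_sum {V : Type*} [Fintype V] [DecidableEq V]
    {A : Matrix V V ℝ} (hA : A.IsHermitian) (x : V → ℝ) :
    x ⬝ᵥ A *ᵥ x = ∑ i, hA.eigenvalues i * (hA.eigenvectorBasis i ⬝ᵥ x) ^ 2 := by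
  have h := hA.eigenvectorBasis.sum_inner_mul_inner (WithLp.toLp 2 x) (WithLp.toLp 2 (A *ᵥ x))
  simp only [EuclideanSpace.inner_eq_star_dotProduct, star_trivial] at h
  rw [dotProduct_comm, ← h]
  refine Finset.sum_congr rfl fun i _ => ?_
  have hsymm : A *ᵥ x ⬝ᵥ hA.eigenvectorBasis i = x ⬝ᵥ A *ᵥ hA.eigenvectorBasis i := by
    rw [dotProduct_mulVec, ← mulVec_transpose]
    congr 2
    simpa using hA.eq.symm
  rw [hsymm, hA.mulVec_eigenvectorBasis, dotProduct_smul, dotProduct_comm x, smul_eq_mul]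
  ring

open Matrix in
lemma Matrix.IsHermitian.dotProduct_self_eq_sum {V : Type*} [Fintype V] [DecidableEq V]
    {A : Matrix V V ℝ} (hA : A.IsHermitian) (x : V → ℝ) :
    x ⬝ᵥ x = ∑ i, (hA.eigenvectorBasis i ⬝ᵥ x) ^ 2 := by
  have h := hA.eigenvectorBasis.sum_inner_mul_inner (WithLp.toLp 2 x) (WithLp.toLp 2 x)
  simp only [EuclideanSpace.inner_eq_star_dotProduct, star_trivial] at h
  rw [← h]
  refine Finset.sum_congr rfl fun i _ => ?_
  rw [dotProduct_comm x, sq]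

open Matrix in
lemma Matrix.IsHermitian.eigenvectorBasis_dotProduct {V : Type*} [Fintype V] [DecidableEq V]
    {A : Matrix V V ℝ} (hA : A.IsHermitian) (i j : V) :
    (hA.eigenvectorBasis i ⬝ᵥ hA.eigenvectorBasis j : ℝ) = if i = j then 1 else 0 := by
  have h := orthonormal_iff_ite.1 hA.eigenvectorBasis.orthonormal j i
  rw [EuclideanSpace.inner_eq_star_dotProduct, star_trivial] at h
  rw [h]
  simp [eq_comm]

/-- Indices of a smallest and a second smallest eigenvalue. -/
lemma Matrix.IsHermitian.exists_eigenvalues_second_smallest {V : Type*} [Fintype V]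
    [DecidableEq V] {A : Matrix V V ℝ} (hA : A.IsHermitian) (h : 2 ≤ Fintype.card V) :
    ∃ i₁ i₂ : V, i₁ ≠ i₂ ∧
      hA.eigenvalues i₂ = hA.eigenvalues₀ ⟨Fintype.card V - 2, by omega⟩ ∧
      hA.eigenvalues i₁ ≤ hA.eigenvalues i₂ ∧
      ∀ j, j ≠ i₁ → hA.eigenvalues i₂ ≤ hA.eigenvalues j := by
  let e : Fin (Fintype.card V) ≃ V := Fintype.equivOfCardEq (Fintype.card_fin _)
  have he : ∀ k, hA.eigenvalues (e k) = hA.eigenvalues₀ k := fun k => by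
    simp [Matrix.IsHermitian.eigenvalues, e]
  refine ⟨e ⟨Fintype.card V - 1, by omega⟩, e ⟨Fintype.card V - 2, by omega⟩, ?_, he _, ?_, ?_⟩
  · intro hc
    have := congrArg Fin.val (e.injective hc)
    simp only at this
    omega
  · rw [he, he]
    exact hA.eigenvalues₀_antitone (by simp only [Fin.mk_le_mk]; omega)
  · intro j hj
    obtain ⟨k, rfl⟩ := e.surjective j
    rw [he, he]
    refine hA.eigenvalues₀_antitone ?_
    have hk : (k : ℕ) ≠ Fintype.card V - 1 := fun hc => hj (congrArg e (Fin.ext hc))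
    have := k.2
    rw [Fin.le_def]
    simp only
    omega

lemma exists_linear_combination_eq_zero (a b : ℝ) :
    ∃ s t : ℝ, s * a + t * b = 0 ∧ 0 < s ^ 2 + t ^ 2 := by
  by_cases h : a = 0
  · exact ⟨1, 0, by simp [h], by norm_num⟩
  · exact ⟨b, -a, by ring, add_pos_of_nonneg_of_pos (sq_nonneg b) (by rw [neg_sq]; positivity)⟩

/-! ### Variational bounds for the algebraic connectivity -/

open scoped Classical in
/-- The Dirichlet energy of a function on the vertices, that is, the quadratic form of the
Laplacian: the sum of the squared differences over the edges. The double sum runs over ordered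
pairs, hence the factor `1 / 2`. -/
noncomputable def dirichletEnergy {V : Type*} [Fintype V] (G : SimpleGraph V) (x : V → ℝ) : ℝ :=
  (∑ i, ∑ j, if G.Adj i j then (x i - x j) ^ 2 else 0) / 2

open Matrix in
open scoped Classical in
lemma dotProduct_lapMatrix_mulVec {V : Type*} [Fintype V] (G : SimpleGraph V) (x : V → ℝ) :
    x ⬝ᵥ G.lapMatrix ℝ *ᵥ x = dirichletEnergy G x := by
  rw [← Matrix.toLinearMap₂'_apply', SimpleGraph.lapMatrix_toLinearMap₂' (R := ℝ)]
  rfl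

open scoped Classical in
lemma algebraicConnectivity_eq {V : Type*} [Fintype V] (G : SimpleGraph V)
    (h : 2 ≤ Fintype.card V) :
    algebraicConnectivity G =
      (G.isHermitian_lapMatrix (R := ℝ)).eigenvalues₀ ⟨Fintype.card V - 2, by omega⟩ := by
  have key : ∀ hV : Finite V, @algebraicConnectivity V hV G =
      (G.isHermitian_lapMatrix (R := ℝ)).eigenvalues₀ ⟨Fintype.card V - 2, by omega⟩ := by
    intro hV
    obtain rfl : ‹Fintype V› = @Fintype.ofFinite V hV := Subsingleton.elim _ _
    unfold algebraicConnectivity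
    exact dif_pos h
  exact key _

open Matrix in
/-- On the plane spanned by eigenvectors for the two smallest eigenvalues the quadratic form is at
most `algebraicConnectivity G` times the squared norm, and that plane contains a nonzero vector
with vanishing sum. -/
theorem le_algebraicConnectivity {V : Type*} [Fintype V] (G : SimpleGraph V)
    (h : 2 ≤ Fintype.card V) (c : ℝ)
    (hc : ∀ x : V → ℝ, ∑ i, x i = 0 → c * ∑ i, x i ^ 2 ≤ dirichletEnergy G x) :
    c ≤ algebraicConnectivity G := by
  classical
  rw [algebraicConnectivity_eq G h]
  set hA := G.isHermitian_lapMatrix (R := ℝ)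
  obtain ⟨i₁, i₂, hne, hi₂, hle, -⟩ := hA.exists_eigenvalues_second_smallest h
  rw [← hi₂]
  obtain ⟨s, t, hst, hpos⟩ := exists_linear_combination_eq_zero
    (∑ v, hA.eigenvectorBasis i₁ v) (∑ v, hA.eigenvectorBasis i₂ v)
  set x : V → ℝ := s • ⇑(hA.eigenvectorBasis i₁) + t • ⇑(hA.eigenvectorBasis i₂) with hx
  have hsum : ∑ v, x v = 0 := by
    simp only [hx, Pi.add_apply, Pi.smul_apply, smul_eq_mul, Finset.sum_add_distrib,
      ← Finset.mul_sum, hst]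
  have hcoef : ∀ i, hA.eigenvectorBasis i ⬝ᵥ x =
      (if i = i₁ then s else 0) + (if i = i₂ then t else 0) := fun i => by
    simp only [hx, dotProduct_add, dotProduct_smul, hA.eigenvectorBasis_dotProduct, smul_eq_mul,
      mul_ite, mul_one, mul_zero]
  have hsq : ∀ i, (hA.eigenvectorBasis i ⬝ᵥ x) ^ 2 =
      (if i = i₁ then s ^ 2 else 0) + (if i = i₂ then t ^ 2 else 0) := fun i => by
    rw [hcoef]
    by_cases h1 : i = i₁
    · simp [h1, hne]
    · simp [h1]
  have hnorm : ∑ i, x i ^ 2 = s ^ 2 + t ^ 2 := by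
    have := hA.dotProduct_self_eq_sum x
    simp only [hsq, Finset.sum_add_distrib, Finset.sum_ite_eq', Finset.mem_univ, if_true] at this
    rw [← this]
    simp [dotProduct, sq]
  have hen : dirichletEnergy G x = hA.eigenvalues i₁ * s ^ 2 + hA.eigenvalues i₂ * t ^ 2 := by
    rw [← dotProduct_lapMatrix_mulVec, hA.dotProduct_mulVec_eq_sum x]
    simp only [hsq, mul_add, Finset.sum_add_distrib, mul_ite, mul_zero, Finset.sum_ite_eq',
      Finset.mem_univ, if_true]
  have h1 := hc x hsum
  rw [hnorm, hen] at h1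
  refine le_of_mul_le_mul_right ?_ hpos
  nlinarith [mul_le_mul_of_nonneg_right hle (sq_nonneg s)]

open Matrix in
/-- The plane spanned by the constants and a nonzero vector `x` with vanishing sum contains a
nonzero vector orthogonal to a bottom eigenvector, and adding constants does not change the
energy. -/
theorem algebraicConnectivity_mul_le {V : Type*} [Fintype V] (G : SimpleGraph V)
    (h : 2 ≤ Fintype.card V) (x : V → ℝ) (hsum : ∑ i, x i = 0) :
    algebraicConnectivity G * ∑ i, x i ^ 2 ≤ dirichletEnergy G x := by
  classical
  have hen0 : 0 ≤ dirichletEnergy G x := by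
    unfold dirichletEnergy
    refine div_nonneg (Finset.sum_nonneg fun i _ => Finset.sum_nonneg fun j _ => ?_) zero_le_two
    split_ifs <;> positivity
  have hx0 : 0 ≤ ∑ i, x i ^ 2 := Finset.sum_nonneg fun i _ => sq_nonneg _
  have hN : (0 : ℝ) < Fintype.card V := by exact_mod_cast (by omega : 0 < Fintype.card V)
  rw [algebraicConnectivity_eq G h]
  set hA := G.isHermitian_lapMatrix (R := ℝ)
  obtain ⟨i₁, i₂, -, hi₂, -, hle⟩ := hA.exists_eigenvalues_second_smallest h
  rw [← hi₂]
  set l := hA.eigenvalues i₂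
  rcases le_or_gt l 0 with hl | hl
  · exact (mul_nonpos_of_nonpos_of_nonneg hl hx0).trans hen0
  obtain ⟨s, t, hst, hpos⟩ := exists_linear_combination_eq_zero
    (hA.eigenvectorBasis i₁ ⬝ᵥ (fun _ => 1)) (hA.eigenvectorBasis i₁ ⬝ᵥ x)
  set y : V → ℝ := s • (fun _ => 1) + t • x with hy
  have horth : hA.eigenvectorBasis i₁ ⬝ᵥ y = 0 := by
    simpa only [hy, dotProduct_add, dotProduct_smul, smul_eq_mul] using hst
  have hyen : dirichletEnergy G y = t ^ 2 * dirichletEnergy G x := by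
    simp only [dirichletEnergy, hy, Pi.add_apply, Pi.smul_apply, smul_eq_mul, mul_div_assoc',
      Finset.mul_sum]
    congr 1
    refine Finset.sum_congr rfl fun i _ => Finset.sum_congr rfl fun j _ => ?_
    split_ifs <;> ring
  have hynorm : ∑ i, y i ^ 2 = s ^ 2 * Fintype.card V + t ^ 2 * ∑ i, x i ^ 2 := by
    have : ∀ i, y i ^ 2 = s ^ 2 + 2 * s * t * x i + t ^ 2 * x i ^ 2 := fun i => by
      simp only [hy, Pi.add_apply, Pi.smul_apply, smul_eq_mul]
      ring
    simp only [this, Finset.sum_add_distrib, ← Finset.mul_sum, hsum]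
    simp [mul_comm]
  have hmain : l * ∑ i, y i ^ 2 ≤ dirichletEnergy G y := by
    have hself : ∑ i, y i ^ 2 = y ⬝ᵥ y := by simp [dotProduct, sq]
    rw [hself, hA.dotProduct_self_eq_sum y, ← dotProduct_lapMatrix_mulVec,
      hA.dotProduct_mulVec_eq_sum y, Finset.mul_sum]
    refine Finset.sum_le_sum fun i _ => ?_
    by_cases hi : i = i₁
    · simp [hi, horth]
    · exact mul_le_mul_of_nonneg_right (hle i hi) (sq_nonneg _)
  rw [hynorm, hyen] at hmain
  -- `t = 0` would give `l * s ^ 2 * card V ≤ 0` with `l`, `s` and `card V` nonzero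
  have ht : 0 < t ^ 2 := by
    by_contra hcon
    have ht0 : t ^ 2 = 0 := le_antisymm (not_lt.1 hcon) (sq_nonneg t)
    rw [ht0, add_zero] at hpos
    rw [ht0, zero_mul, zero_mul, add_zero] at hmain
    exact absurd hmain (not_le.2 (by positivity))
  refine le_of_mul_le_mul_left ?_ ht
  nlinarith [mul_nonneg hl.le (mul_nonneg (sq_nonneg s) hN.le)]

/-! ### Complete multipartite graphs -/

open scoped Classical in
/-- The energy of a complete multipartite graph, whose parts are the fibres of `f`. -/
lemma dirichletEnergy_of_adj_iff_ne {V ι : Type*} [Fintype V] {G : SimpleGraph V} {f : V → ι}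
    (hG : ∀ i j, G.Adj i j ↔ f i ≠ f j) {x : V → ℝ} (hx : ∑ i, x i = 0) :
    dirichletEnergy G x =
      ∑ i, ((Fintype.card V : ℝ) - (Finset.univ.filter fun j => f j = f i).card) * x i ^ 2 +
        ∑ c ∈ Finset.univ.image f, (∑ j with f j = c, x j) ^ 2 := by
  set e : V → V → ℝ := fun i j => if f j = f i then 1 else 0 with he
  have hesymm : ∀ i j, e i j = e j i := fun i j => by simp only [he, eq_comm]
  have hsplit : ∀ i j, (if G.Adj i j then (x i - x j) ^ 2 else 0) =
      (1 - e i j) * x i ^ 2 + (1 - e j i) * x j ^ 2 - 2 * (x i * x j) + 2 * (x i * (e i j * x j)) :=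
    fun i j => by
      rw [hesymm j i]
      by_cases h : f i = f j
      · simp only [hG, he, h]
        simp
      · simp only [hG, he, ne_eq, h, Ne.symm h, not_false_eq_true, if_true, if_false]
        ring
  have hdeg : ∀ i, ∑ j, (1 - e i j) * x i ^ 2 =
      ((Fintype.card V : ℝ) - (Finset.univ.filter fun j => f j = f i).card) * x i ^ 2 :=
    fun i => by
      rw [← Finset.sum_mul, Finset.sum_sub_distrib]
      simp [he]
  have hprod : ∑ i, ∑ j, x i * x j = 0 := by
    rw [← Finset.sum_mul_sum, hx, zero_mul]
  have hfib : ∑ i, ∑ j, x i * (e i j * x j) =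
      ∑ c ∈ Finset.univ.image f, (∑ j with f j = c, x j) ^ 2 := by
    rw [← Finset.sum_fiberwise_of_maps_to (t := Finset.univ.image f) (g := f)
      fun i _ => Finset.mem_image_of_mem f (Finset.mem_univ i)]
    refine Finset.sum_congr rfl fun c _ => ?_
    rw [sq, Finset.sum_mul]
    refine Finset.sum_congr rfl fun i hi => ?_
    rw [← Finset.mul_sum, Finset.sum_filter]
    simp only [he, (Finset.mem_filter.1 hi).2, ite_mul, one_mul, zero_mul]
  unfold dirichletEnergy
  simp only [hsplit, Finset.sum_add_distrib, Finset.sum_sub_distrib, ← Finset.mul_sum (a := (2 : ℝ)),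
    hprod, hfib]
  rw [Finset.sum_comm (f := fun i j => (1 - e j i) * x j ^ 2)]
  simp only [hdeg]
  ring

open scoped Classical in
/-- The fibre sums in the energy are squares, which gives the lower bound; they vanish for the
difference of the indicators of two vertices in a largest part, which gives the upper bound. -/
theorem algebraicConnectivity_of_adj_iff_ne {V ι : Type*} [Fintype V] {G : SimpleGraph V}
    {f : V → ι} (hG : ∀ i j, G.Adj i j ↔ f i ≠ f j) {M : ℕ}
    (hM : ∀ i, (Finset.univ.filter fun j => f j = f i).card ≤ M) {u v : V} (huv : u ≠ v)
    (hfuv : f u = f v) (hu : (Finset.univ.filter fun j => f j = f u).card = M) :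
    algebraicConnectivity G = (Fintype.card V : ℝ) - M := by
  have hcard : 2 ≤ Fintype.card V := Fintype.one_lt_card_iff.2 ⟨u, v, huv⟩
  apply le_antisymm
  · set x : V → ℝ := fun i => (if i = u then 1 else 0) - (if i = v then 1 else 0) with hx
    have hsum : ∑ i, x i = 0 := by simp [hx]
    have hfib : ∀ c, ∑ j with f j = c, x j = 0 := fun c => by
      simp only [hx, Finset.sum_sub_distrib, Finset.sum_ite_eq',
        Finset.mem_filter, Finset.mem_univ, true_and, hfuv, sub_self]
    have hxu : x u = 1 := by simp [hx, huv]
    have hpos : 0 < ∑ i, x i ^ 2 :=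
      Finset.sum_pos' (fun i _ => sq_nonneg _) ⟨u, Finset.mem_univ u, by simp [hxu]⟩
    have h := algebraicConnectivity_mul_le G hcard x hsum
    rw [dirichletEnergy_of_adj_iff_ne hG hsum] at h
    simp only [hfib] at h
    have hterm : ∀ i, ((Fintype.card V : ℝ) -
        (Finset.univ.filter fun j => f j = f i).card) * x i ^ 2 =
        ((Fintype.card V : ℝ) - M) * x i ^ 2 := fun i => by
      by_cases hiu : i = u
      · rw [hiu, hu]
      by_cases hiv : i = v
      · rw [hiv, ← hfuv, hu]
      · simp [hx, hiu, hiv]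
    simp only [hterm, ← Finset.mul_sum, ne_eq, OfNat.ofNat_ne_zero, not_false_eq_true, zero_pow,
      Finset.sum_const_zero, add_zero] at h
    exact le_of_mul_le_mul_right h hpos
  · refine le_algebraicConnectivity G hcard _ fun x hsum => ?_
    rw [dirichletEnergy_of_adj_iff_ne hG hsum, Finset.mul_sum]
    refine le_add_of_le_of_nonneg (Finset.sum_le_sum fun i _ => ?_)
      (Finset.sum_nonneg fun c _ => sq_nonneg _)
    have : ((Finset.univ.filter fun j => f j = f i).card : ℝ) ≤ M := by exact_mod_cast hM i
    exact mul_le_mul_of_nonneg_right (by linarith) (sq_nonneg _)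

open scoped Classical in
/-- What is left of a complete multipartite graph is disconnected exactly if it consists of at
least two vertices of a single part. -/
theorem vertexConnectivity_of_adj_iff_ne {V ι : Type*} [Fintype V] {G : SimpleGraph V}
    {f : V → ι} (hG : ∀ i j, G.Adj i j ↔ f i ≠ f j) {M : ℕ}
    (hM : ∀ i, (Finset.univ.filter fun j => f j = f i).card ≤ M) {u v : V} (huv : u ≠ v)
    (hfuv : f u = f v) (hu : (Finset.univ.filter fun j => f j = f u).card = M) :
    vertexConnectivity G + M = Fintype.card V := by
  have hMle : M ≤ Fintype.card V := hu ▸ Finset.card_le_univ _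
  have htop : G ≠ ⊤ := fun h => by
    have := (hG u v).1 (by rw [h]; exact huv)
    exact this hfuv
  suffices h : vertexConnectivity G = Fintype.card V - M by omega
  unfold vertexConnectivity
  rw [if_neg htop]
  refine IsLeast.csInf_eq ⟨⟨(Finset.univ.filter fun j => f j = f u)ᶜ, ?_, ?_⟩, ?_⟩
  · rw [Finset.card_compl, hu]
  · intro hpre
    have hnt : Nontrivial
        ((((Finset.univ.filter fun j => f j = f u)ᶜ : Finset V) : Set V)ᶜ : Set V) :=
      ⟨⟨u, by simp⟩, ⟨v, by simp [hfuv]⟩, by simpa using huv⟩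
    obtain ⟨w, hw⟩ := hpre.exists_adj_of_nontrivial ⟨u, by simp⟩
    have h1 := (hG _ _).1 (SimpleGraph.induce_adj.1 hw)
    have h2 := w.2
    simp only [Finset.coe_compl, compl_compl, Finset.coe_filter, Finset.mem_univ, true_and,
      Set.mem_ofPred_eq] at h2
    exact h1 h2.symm
  · rintro c ⟨S, rfl, hS⟩
    rw [SimpleGraph.Preconnected] at hS
    push Not at hS
    obtain ⟨a, b, hab⟩ := hS
    have hfab : f a.1 = f b.1 := by
      by_contra hne
      exact hab (SimpleGraph.Adj.reachable (SimpleGraph.induce_adj.2 ((hG _ _).2 hne)))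
    have hsub : Sᶜ ⊆ Finset.univ.filter fun j => f j = f a.1 := fun j hj => by
      rw [Finset.mem_filter]
      refine ⟨Finset.mem_univ j, ?_⟩
      by_contra hne
      have hj' : j ∈ ((S : Set V)ᶜ) := by simpa using hj
      -- otherwise `j` is adjacent to both `a` and `b`
      have h1 : (G.induce ((S : Set V)ᶜ)).Adj a ⟨j, hj'⟩ :=
        SimpleGraph.induce_adj.2 ((hG _ _).2 (Ne.symm hne))
      have h2 : (G.induce ((S : Set V)ᶜ)).Adj ⟨j, hj'⟩ b :=
        SimpleGraph.induce_adj.2 ((hG _ _).2 (hfab ▸ hne))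
      exact hab (h1.reachable.trans h2.reachable)
    have h1 := (Finset.card_le_card hsub).trans (hM a.1)
    rw [Finset.card_compl] at h1
    omega

/-! ### Graphs with a pendant vertex -/

/-- The test function vanishes at the neighbour `u` of the pendant vertex `v`, is constant on the
remaining vertices other than `v`, and is balanced by its value at `v`. Only edges at `u` carry
energy, so the energy would be the squared norm if `u` were adjacent to every vertex; the missing
edge `u w` makes it smaller. -/
theorem algebraicConnectivity_lt_one_of_pendant {V : Type*} [Fintype V] {G : SimpleGraph V}
    {u v w : V} (hv : ∀ z, G.Adj v z → z = u) (hvu : v ≠ u) (hwu : w ≠ u) (hwv : w ≠ v)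
    (huw : ¬ G.Adj u w) : algebraicConnectivity G < 1 := by
  classical
  have hcard : 2 ≤ Fintype.card V := Fintype.one_lt_card_iff.2 ⟨u, v, hvu.symm⟩
  set x : V → ℝ := fun i =>
    (if i = v then (Fintype.card V : ℝ) - 1 else 0) + (if i = u then 1 else 0) - 1 with hx
  have hsum : ∑ i, x i = 0 := by simp [hx, Finset.sum_add_distrib, Finset.sum_sub_distrib]
  have hxu : x u = 0 := by simp [hx, hvu.symm]
  have hxo : ∀ i, i ≠ u → i ≠ v → x i = -1 := fun i h1 h2 => by simp [hx, h1, h2]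
  have hterm : ∀ i j, (if G.Adj i j then (x i - x j) ^ 2 else 0) ≤
      (if j = u then (if i = w then 0 else x i ^ 2) else 0) +
        (if i = u then (if j = w then 0 else x j ^ 2) else 0) := by
    intro i j
    by_cases hadj : G.Adj i j
    · rw [if_pos hadj]
      by_cases hju : j = u
      · subst hju
        have hiw : i ≠ w := fun h => huw (h ▸ hadj.symm)
        simp [hiw, hxu, hadj.ne]
      by_cases hiu : i = u
      · subst hiu
        have hjw : j ≠ w := fun h => huw (h ▸ hadj)
        simp [hjw, hxu, hju]
      · have hiv : i ≠ v := fun h => hju (hv j (h ▸ hadj))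
        have hjv : j ≠ v := fun h => hiu (hv i (h ▸ hadj.symm))
        simp [hju, hiu, hxo i hiu hiv, hxo j hju hjv]
    · rw [if_neg hadj]
      split_ifs <;> positivity
  have hsq : ∑ i, (if i = w then 0 else x i ^ 2) = ∑ i, x i ^ 2 - 1 := by
    have : ∀ i, (if i = w then 0 else x i ^ 2) = x i ^ 2 - if i = w then 1 else 0 := fun i => by
      by_cases h : i = w
      · simp [h, hxo w hwu hwv]
      · simp [h]
    simp [this]
  have hen : dirichletEnergy G x ≤ ∑ i, x i ^ 2 - 1 := by
    have h : ∑ i, ∑ j, (if G.Adj i j then (x i - x j) ^ 2 else 0) ≤ 2 * (∑ i, x i ^ 2 - 1) := by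
      refine (Finset.sum_le_sum fun i _ => Finset.sum_le_sum fun j _ => hterm i j).trans
        (le_of_eq ?_)
      simp only [Finset.sum_add_distrib]
      rw [Finset.sum_comm (f := fun i j => if i = u then (if j = w then 0 else x j ^ 2) else 0)]
      simp only [Finset.sum_ite_eq', Finset.mem_univ, if_true, hsq]
      ring
    unfold dirichletEnergy
    have h' : (∑ i, ∑ j, (if G.Adj i j then (x i - x j) ^ 2 else 0)) / 2 ≤
      ∑ i, x i ^ 2 - 1 := by linarith
    convert h'
  have hpos : 0 < ∑ i, x i ^ 2 :=
    Finset.sum_pos' (fun i _ => sq_nonneg _) ⟨w, Finset.mem_univ w, by simp [hxo w hwu hwv]⟩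
  by_contra! hcon
  have h1 := algebraicConnectivity_mul_le G hcard x hsum
  have h2 := mul_le_mul_of_nonneg_right hcon hpos.le
  linarith

/-- The pendant vertex serves to see that some vertex set disconnects the graph, so that the
infimum in the definition of the vertex connectivity is attained. -/
theorem one_le_vertexConnectivity_of_pendant {V : Type*} [Finite V] {G : SimpleGraph V}
    (hG : G.Preconnected) {u v w : V} (hv : ∀ z, G.Adj v z → z = u) (hvu : v ≠ u) (hwu : w ≠ u)
    (hwv : w ≠ v) : 1 ≤ vertexConnectivity G := by
  classical
  have htop : G ≠ ⊤ := fun h => hwu (hv w (by rw [h]; exact hwv.symm))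
  unfold vertexConnectivity
  rw [if_neg htop, Nat.one_le_iff_ne_zero, Ne, Nat.sInf_eq_zero, not_or]
  constructor
  · rintro ⟨S, hS, hpre⟩
    rw [Finset.card_eq_zero] at hS
    subst hS
    rw [Finset.coe_empty, Set.compl_empty] at hpre
    exact hpre ((SimpleGraph.induceUnivIso G).preconnected_iff.2 hG)
  · refine Set.Nonempty.ne_empty ⟨_, {u}, rfl, fun hpre => ?_⟩
    have hnt : Nontrivial ((({u} : Finset V) : Set V)ᶜ : Set V) :=
      ⟨⟨v, by simpa using hvu⟩, ⟨w, by simpa using hwu⟩, by simpa using hwv.symm⟩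
    obtain ⟨z, hz⟩ := hpre.exists_adj_of_nontrivial ⟨v, by simpa using hvu⟩
    have h1 := hv _ (SimpleGraph.induce_adj.1 hz)
    have h2 := z.2
    simp [h1] at h2

/-! ### Ideals of `ZMod n` and divisors of `n` -/

/-- The divisor of `n` attached to an ideal of `ZMod n`: the nonnegative generator of its preimage
in `ℤ`. -/
noncomputable def idealDivisor {n : ℕ} (I : Ideal (ZMod n)) : ℕ :=
  (Submodule.IsPrincipal.generator (I.comap (Int.castRingHom (ZMod n)))).natAbs

section idealDivisor

variable {n : ℕ}

lemma intCast_mem_iff_idealDivisor_dvd (I : Ideal (ZMod n)) (x : ℤ) :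
    (x : ZMod n) ∈ I ↔ (idealDivisor I : ℤ) ∣ x := by
  rw [idealDivisor, Int.natAbs_dvd, ← Submodule.IsPrincipal.mem_iff_generator_dvd]
  rfl

lemma natCast_mem_iff_idealDivisor_dvd (I : Ideal (ZMod n)) (x : ℕ) :
    (x : ZMod n) ∈ I ↔ idealDivisor I ∣ x := by
  rw [← Int.natCast_dvd_natCast, ← intCast_mem_iff_idealDivisor_dvd, Int.cast_natCast]

lemma idealDivisor_dvd (I : Ideal (ZMod n)) : idealDivisor I ∣ n := by
  rw [← natCast_mem_iff_idealDivisor_dvd, ZMod.natCast_self]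
  exact I.zero_mem

lemma idealDivisor_dvd_iff_le {I J : Ideal (ZMod n)} :
    idealDivisor J ∣ idealDivisor I ↔ I ≤ J := by
  constructor
  · intro h x hx
    obtain ⟨x, rfl⟩ := ZMod.intCast_surjective x
    rw [intCast_mem_iff_idealDivisor_dvd] at hx ⊢
    exact (Int.natCast_dvd_natCast.2 h).trans hx
  · intro h
    rw [← natCast_mem_iff_idealDivisor_dvd]
    exact h ((natCast_mem_iff_idealDivisor_dvd I _).2 dvd_rfl)

lemma idealDivisor_injective : Function.Injective (idealDivisor (n := n)) := fun _ _ h =>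
  le_antisymm (idealDivisor_dvd_iff_le.1 h.symm.dvd) (idealDivisor_dvd_iff_le.1 h.dvd)

lemma idealDivisor_span {d : ℕ} (hd : d ∣ n) : idealDivisor (Ideal.span {(d : ZMod n)}) = d := by
  have key : ∀ x : ℕ, idealDivisor (Ideal.span {(d : ZMod n)}) ∣ x ↔ d ∣ x := fun x => by
    rw [← natCast_mem_iff_idealDivisor_dvd, Ideal.mem_span_singleton]
    constructor
    · rintro ⟨c, hc⟩
      obtain ⟨c, rfl⟩ := ZMod.intCast_surjective c
      have h : ((x : ℤ) : ZMod n) = ((d * c : ℤ) : ZMod n) := by push_cast; exact hc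
      rw [ZMod.intCast_eq_intCast_iff_dvd_sub] at h
      rw [← Int.natCast_dvd_natCast] at hd ⊢
      exact (dvd_sub_right (dvd_mul_right _ _)).1 (hd.trans h)
    · exact fun h => by exact_mod_cast Nat.cast_dvd_cast h
  exact Nat.dvd_antisymm ((key d).2 dvd_rfl) ((key _).1 dvd_rfl)

lemma idealDivisor_bot : idealDivisor (⊥ : Ideal (ZMod n)) = n := by
  refine Nat.dvd_antisymm (idealDivisor_dvd _) ?_
  rw [← ZMod.natCast_eq_zero_iff, ← Ideal.mem_bot, natCast_mem_iff_idealDivisor_dvd]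

lemma idealDivisor_top : idealDivisor (⊤ : Ideal (ZMod n)) = 1 :=
  Nat.dvd_one.1 ((natCast_mem_iff_idealDivisor_dvd ⊤ 1).1 Submodule.mem_top)

lemma idealDivisor_eq_iff_eq_bot {I : Ideal (ZMod n)} : idealDivisor I = n ↔ I = ⊥ := by
  conv_lhs => rhs; rw [← idealDivisor_bot (n := n)]
  exact idealDivisor_injective.eq_iff

lemma idealDivisor_eq_one_iff {I : Ideal (ZMod n)} : idealDivisor I = 1 ↔ I = ⊤ := by
  rw [← idealDivisor_top (n := n), idealDivisor_injective.eq_iff]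

lemma idealDivisor_inf (I J : Ideal (ZMod n)) :
    idealDivisor (I ⊓ J) = Nat.lcm (idealDivisor I) (idealDivisor J) := by
  refine eq_of_forall_dvd fun x => ?_
  rw [Nat.lcm_dvd_iff, ← natCast_mem_iff_idealDivisor_dvd, Submodule.mem_inf,
    natCast_mem_iff_idealDivisor_dvd, natCast_mem_iff_idealDivisor_dvd]

lemma idealDivisor_add (I J : Ideal (ZMod n)) :
    idealDivisor (I + J) = Nat.gcd (idealDivisor I) (idealDivisor J) := by
  have hspan := idealDivisor_span ((Nat.gcd_dvd_left _ (idealDivisor J)).trans (idealDivisor_dvd I))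
  refine Nat.dvd_antisymm ?_ ?_
  · exact Nat.dvd_gcd (idealDivisor_dvd_iff_le.2 le_sup_left) (idealDivisor_dvd_iff_le.2 le_sup_right)
  · rw [← hspan, idealDivisor_dvd_iff_le]
    refine sup_le ?_ ?_ <;> rw [← idealDivisor_dvd_iff_le, hspan]
    exacts [Nat.gcd_dvd_left _ _, Nat.gcd_dvd_right _ _]

/-- The ideals generated by `n / p` for primes `p` are the minimal ones, so an ideal is essential
exactly if it contains all of them. -/
theorem isEssentialIdeal_iff_dvd_div [NeZero n] (I : Ideal (ZMod n)) :
    IsEssentialIdeal I ↔ ∀ p : ℕ, p.Prime → p ∣ n → idealDivisor I ∣ n / p := by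
  have hn : 0 < n := Nat.pos_of_ne_zero (NeZero.ne n)
  constructor
  · intro h p hp hpn
    obtain ⟨m, rfl⟩ := hpn
    have hm : 0 < m := Nat.pos_of_mul_pos_left hn
    rw [Nat.mul_div_cancel_left _ hp.pos]
    have hspan := idealDivisor_span (n := p * m) (dvd_mul_left m p)
    have hne : Ideal.span {(m : ZMod (p * m))} ≠ ⊥ := fun hbot => by
      rw [← idealDivisor_eq_iff_eq_bot, hspan] at hbot
      exact hp.one_lt.ne (Nat.eq_of_mul_eq_mul_right hm (by rw [one_mul]; exact hbot))
    have hinf := h _ hne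
    rw [Ne, ← idealDivisor_eq_iff_eq_bot, idealDivisor_inf, hspan] at hinf
    -- the least common multiple lies between `m` and `p * m`
    obtain ⟨t, ht⟩ := Nat.dvd_lcm_right (idealDivisor I) m
    have htp : t ∣ p := by
      have h1 : Nat.lcm (idealDivisor I) m ∣ p * m :=
        Nat.lcm_dvd (idealDivisor_dvd I) (dvd_mul_left _ _)
      rw [ht, mul_comm p m] at h1
      exact Nat.dvd_of_mul_dvd_mul_left hm h1
    rcases (Nat.dvd_prime hp).1 htp with ht1 | ht1
    · rw [ht1, mul_one] at ht
      exact (Nat.dvd_lcm_left (idealDivisor I) m).trans ht.dvd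
    · rw [ht1] at ht
      exact absurd (ht.trans (mul_comm _ _)) hinf
  · intro h K hK hinf
    rw [← idealDivisor_eq_iff_eq_bot, idealDivisor_inf] at hinf
    rw [Ne, ← idealDivisor_eq_iff_eq_bot] at hK
    obtain ⟨t, ht⟩ := idealDivisor_dvd K
    have ht1 : t ≠ 1 := fun h1 => hK (by rw [h1, mul_one] at ht; exact ht.symm)
    obtain ⟨p, hp, s, rfl⟩ := Nat.exists_prime_and_dvd ht1
    have hpn : p ∣ n := ⟨idealDivisor K * s, ht.trans (by ring)⟩
    have hK' : idealDivisor K ∣ n / p :=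
      ⟨s, Nat.div_eq_of_eq_mul_right hp.pos (ht.trans (by ring))⟩
    have hdvd := Nat.lcm_dvd (h p hp hpn) hK'
    rw [hinf] at hdvd
    have h1 := Nat.le_of_dvd (Nat.div_pos (Nat.le_of_dvd hn hpn) hp.pos) hdvd
    exact absurd h1 (not_le.2 (Nat.div_lt_self hn hp.one_lt))

/-- The vertex of the essential ideal graph given by a divisor of `n` other than `1` and `n`. -/
noncomputable def vertexOfDivisor (d : ℕ) (hd : d ∣ n) (h1 : d ≠ 1) (hn : d ≠ n) :
    NonzeroProperIdeal (ZMod n) :=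
  ⟨Ideal.span {(d : ZMod n)},
    fun h => hn (by rw [← idealDivisor_span hd, idealDivisor_eq_iff_eq_bot, h]),
    fun h => h1 (by rw [← idealDivisor_span hd, idealDivisor_eq_one_iff, h])⟩

lemma idealDivisor_vertexOfDivisor {d : ℕ} (hd : d ∣ n) (h1 : d ≠ 1) (hn : d ≠ n) :
    idealDivisor (vertexOfDivisor d hd h1 hn).1 = d :=
  idealDivisor_span hd

lemma idealDivisor_ne_one (I : NonzeroProperIdeal (ZMod n)) : idealDivisor I.1 ≠ 1 :=
  fun h => I.2.2 (idealDivisor_eq_one_iff.1 h)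

lemma idealDivisor_ne_self (I : NonzeroProperIdeal (ZMod n)) : idealDivisor I.1 ≠ n :=
  fun h => I.2.1 (idealDivisor_eq_iff_eq_bot.1 h)

lemma vertex_eq_iff {I K : NonzeroProperIdeal (ZMod n)} :
    I = K ↔ idealDivisor I.1 = idealDivisor K.1 := by
  rw [idealDivisor_injective.eq_iff, Subtype.ext_iff]

/-- Counting vertices amounts to counting divisors. -/
lemma card_filter_vertices [NeZero n] [Fintype (NonzeroProperIdeal (ZMod n))] (P : ℕ → Prop)
    [DecidablePred P] :
    (Finset.univ.filter fun I : NonzeroProperIdeal (ZMod n) => P (idealDivisor I.1)).card =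
      (n.divisors.filter fun d => d ≠ 1 ∧ d ≠ n ∧ P d).card := by
  refine Finset.card_bij (fun I _ => idealDivisor I.1) ?_ ?_ ?_
  · intro I hI
    simp only [Finset.mem_filter, Finset.mem_univ, true_and] at hI
    simp only [Finset.mem_filter, Nat.mem_divisors]
    exact ⟨⟨idealDivisor_dvd _, NeZero.ne n⟩, idealDivisor_ne_one I, idealDivisor_ne_self I, hI⟩
  · exact fun I _ K _ h => vertex_eq_iff.2 h
  · intro d hd
    simp only [Finset.mem_filter, Nat.mem_divisors] at hd
    obtain ⟨⟨hdn, -⟩, h1, hn, hP⟩ := hd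
    refine ⟨vertexOfDivisor d hdn h1 hn, ?_, idealDivisor_vertexOfDivisor hdn h1 hn⟩
    simpa [idealDivisor_vertexOfDivisor hdn h1 hn] using hP

end idealDivisor

/-! ### Squarefree modulus -/

section squarefree

variable {n : ℕ} [NeZero n]

lemma essentialIdealGraph_adj_iff_coprime (hn : Squarefree n)
    {I K : NonzeroProperIdeal (ZMod n)} :
    (essentialIdealGraph (ZMod n)).Adj I K ↔
      Nat.Coprime (idealDivisor I.1) (idealDivisor K.1) := by
  change (I ≠ K ∧ IsEssentialIdeal (I.1 + K.1)) ↔ _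
  rw [isEssentialIdeal_iff_dvd_div, idealDivisor_add]
  constructor
  · rintro ⟨-, h⟩
    refine Nat.coprime_of_dvd fun q hq hqI hqK => ?_
    have hqg := Nat.dvd_gcd hqI hqK
    have hqn : q ∣ n := hqI.trans (idealDivisor_dvd _)
    have hqq : q * q ∣ n := by
      obtain ⟨t, ht⟩ := hqg.trans (h q hq hqn)
      exact ⟨t, by rw [mul_assoc, ← ht, Nat.mul_div_cancel' hqn]⟩
    exact hq.one_lt.ne' (Nat.isUnit_iff.1 (hn q hqq))
  · intro h
    refine ⟨?_, fun p _ _ => by rw [h]; exact one_dvd _⟩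
    rintro rfl
    exact idealDivisor_ne_one I ((Nat.coprime_self _).1 h)

/-- A vertex `d` is adjacent to every prime dividing `n / d`, and distinct primes are adjacent. -/
theorem essentialIdealGraph_preconnected (hn : Squarefree n) :
    (essentialIdealGraph (ZMod n)).Preconnected := by
  -- the prime is not `n` itself: the divisor of `I` is not `1`, divides `n` and is prime to it
  have key : ∀ I : NonzeroProperIdeal (ZMod n), ∃ Q : NonzeroProperIdeal (ZMod n),
      (idealDivisor Q.1).Prime ∧ (essentialIdealGraph (ZMod n)).Adj I Q := by
    intro I
    obtain ⟨t, ht⟩ := idealDivisor_dvd I.1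
    have ht1 : t ≠ 1 := fun h => idealDivisor_ne_self I (by rw [h, mul_one] at ht; exact ht.symm)
    obtain ⟨q, hq, hqt⟩ := Nat.exists_prime_and_dvd ht1
    have hqn : q ∣ n := ht ▸ hqt.mul_left _
    have hcop : Nat.Coprime (idealDivisor I.1) q :=
      (Nat.coprime_of_squarefree_mul (ht ▸ hn)).coprime_dvd_right hqt
    have hqne : q ≠ n := fun h =>
      idealDivisor_ne_one I (Nat.Coprime.eq_one_of_dvd hcop (h ▸ idealDivisor_dvd I.1))
    refine ⟨vertexOfDivisor q hqn hq.ne_one hqne, ?_, ?_⟩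
    · rwa [idealDivisor_vertexOfDivisor]
    · rwa [essentialIdealGraph_adj_iff_coprime hn, idealDivisor_vertexOfDivisor]
  intro I K
  obtain ⟨Q, hQ, hIQ⟩ := key I
  obtain ⟨R, hR, hKR⟩ := key K
  refine hIQ.reachable.trans (SimpleGraph.Reachable.trans ?_ hKR.symm.reachable)
  by_cases h : Q = R
  · rw [h]
  · refine SimpleGraph.Adj.reachable ((essentialIdealGraph_adj_iff_coprime hn).2 ?_)
    exact (Nat.coprime_primes hQ hR).2 fun hc => h (vertex_eq_iff.2 hc)

/-- For three primes `p`, `q`, `r` dividing the squarefree number `n`, the vertex `n / p` is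
pendant with neighbour `p`, and `p * q` is not adjacent to `p`. -/
theorem algebraicConnectivity_lt_vertexConnectivity_of_squarefree (hn : Squarefree n) {p q r : ℕ}
    (hp : p.Prime) (hq : q.Prime) (hr : r.Prime) (hpr : p ≠ r) (hqr : q ≠ r)
    (hdvd : p * q * r ∣ n) :
    algebraicConnectivity (essentialIdealGraph (ZMod n)) <
      (vertexConnectivity (essentialIdealGraph (ZMod n)) : ℝ) := by
  classical
  let _ : Fintype (NonzeroProperIdeal (ZMod n)) := Fintype.ofFinite _
  obtain ⟨m, hm⟩ := hdvd
  have hpn : p ∣ n := ⟨q * r * m, by rw [hm]; ring⟩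
  have hpqn : p * q ∣ n := ⟨r * m, by rw [hm]; ring⟩
  have hdiv : n = p * (q * r * m) := by rw [hm]; ring
  have hdn : q * r * m ∣ n := ⟨p, by rw [hm]; ring⟩
  have hrn : r ∣ n := ⟨p * q * m, by rw [hm]; ring⟩
  have hcop : Nat.Coprime p (q * r * m) := Nat.coprime_of_squarefree_mul (hdiv ▸ hn)
  have hrp : ¬ r ∣ p := fun h => hpr ((Nat.prime_dvd_prime_iff_eq hr hp).1 h).symm
  have hrpq : ¬ r ∣ p * q := fun h => (hr.dvd_mul.1 h).elim hrp
    fun h => hqr ((Nat.prime_dvd_prime_iff_eq hr hq).1 h).symm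
  set u := vertexOfDivisor p hpn hp.ne_one fun h => hrp (h ▸ hrn) with hu
  set v := vertexOfDivisor (q * r * m) hdn
    (fun h => hq.ne_one (Nat.dvd_one.1 (h ▸ ⟨r * m, by ring⟩)))
    (fun h => hp.ne_one (Nat.Coprime.eq_one_of_dvd hcop (h ▸ hpn))) with hv
  set w := vertexOfDivisor (p * q) hpqn
    (fun h => hp.ne_one (Nat.dvd_one.1 (h ▸ dvd_mul_right p q))) fun h => hrpq (h ▸ hrn) with hw
  have hu' : idealDivisor u.1 = p := idealDivisor_vertexOfDivisor _ _ _
  have hv' : idealDivisor v.1 = q * r * m := idealDivisor_vertexOfDivisor _ _ _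
  have hw' : idealDivisor w.1 = p * q := idealDivisor_vertexOfDivisor _ _ _
  have hpend : ∀ z, (essentialIdealGraph (ZMod n)).Adj v z → z = u := by
    intro z hz
    rw [essentialIdealGraph_adj_iff_coprime hn, hv'] at hz
    have hzp : idealDivisor z.1 ∣ p := by
      have h : idealDivisor z.1 ∣ p * (q * r * m) := (idealDivisor_dvd z.1).trans hdiv.dvd
      exact hz.symm.dvd_of_dvd_mul_right h
    rw [vertex_eq_iff, hu']
    exact ((Nat.dvd_prime hp).1 hzp).resolve_left (idealDivisor_ne_one z)
  have hvu : v ≠ u := fun h => by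
    rw [vertex_eq_iff, hu', hv'] at h
    exact hrp ⟨q * m, by rw [← h]; ring⟩
  have hwu : w ≠ u := fun h => by
    rw [vertex_eq_iff, hu', hw'] at h
    exact hq.ne_one (Nat.eq_of_mul_eq_mul_left hp.pos (by rw [h, mul_one]))
  have hwv : w ≠ v := fun h => by
    rw [vertex_eq_iff, hv', hw'] at h
    exact hrpq ⟨q * m, by rw [h]; ring⟩
  have huw : ¬ (essentialIdealGraph (ZMod n)).Adj u w := fun h => by
    rw [essentialIdealGraph_adj_iff_coprime hn, hu', hw'] at h
    exact hp.ne_one (Nat.Coprime.eq_one_of_dvd h (dvd_mul_right p q))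
  calc algebraicConnectivity (essentialIdealGraph (ZMod n)) < 1 :=
        algebraicConnectivity_lt_one_of_pendant hpend hvu hwu hwv huw
    _ ≤ _ := by
        exact_mod_cast one_le_vertexConnectivity_of_pendant
          (essentialIdealGraph_preconnected hn) hpend hvu hwu hwv

end squarefree

/-! ### Moduli with two prime factors -/

lemma dvd_div_prime_iff_not_pow_dvd {p a r g : ℕ} (hp : p.Prime) (hpr : ¬ p ∣ r)
    (hg : g ∣ p ^ a * r) (hdvd : p ∣ p ^ a * r) :
    g ∣ p ^ a * r / p ↔ ¬ p ^ a ∣ g := by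
  constructor
  · intro h hpg
    have h1 : p ^ a * p ∣ p ^ a * r := by
      obtain ⟨t, ht⟩ := hpg.trans h
      refine ⟨t, ?_⟩
      rw [← Nat.div_mul_cancel hdvd, ht]
      ring
    exact hpr (Nat.dvd_of_mul_dvd_mul_left (pow_pos hp.pos a) h1)
  · intro h
    obtain ⟨t, ht⟩ := hg
    have hpt : p ∣ t := by
      by_contra hpt
      have hcop : Nat.Coprime (p ^ a) t := Nat.Coprime.pow_left a ((hp.coprime_iff_not_dvd).2 hpt)
      exact h (hcop.dvd_of_dvd_mul_right (ht ▸ dvd_mul_right _ _))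
    obtain ⟨s, rfl⟩ := hpt
    exact ⟨s, Nat.div_eq_of_eq_mul_right hp.pos (ht.trans (by ring))⟩

lemma card_filter_pow_dvd_divisors {p q a b : ℕ} (hp : p.Prime) (hq : q.Prime) (ha : 1 ≤ a) :
    ((p ^ a * q ^ b).divisors.filter
      fun d => d ≠ 1 ∧ d ≠ p ^ a * q ^ b ∧ p ^ a ∣ d).card = b := by
  have hpos : 0 < p ^ a := pow_pos hp.pos a
  have hinj : Function.Injective fun j => p ^ a * q ^ j := fun i j h =>
    Nat.pow_right_injective hq.two_le (Nat.eq_of_mul_eq_mul_left hpos h)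
  have heq : ((p ^ a * q ^ b).divisors.filter
      fun d => d ≠ 1 ∧ d ≠ p ^ a * q ^ b ∧ p ^ a ∣ d) =
      (Finset.range b).image fun j => p ^ a * q ^ j := by
    ext d
    simp only [Finset.mem_filter, Nat.mem_divisors, Finset.mem_image, Finset.mem_range]
    constructor
    · rintro ⟨⟨hd, -⟩, -, hne, e, rfl⟩
      obtain ⟨j, hj, rfl⟩ := (Nat.dvd_prime_pow hq).1 (Nat.dvd_of_mul_dvd_mul_left hpos hd)
      exact ⟨j, lt_of_le_of_ne hj fun h => hne (by rw [h]), rfl⟩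
    · rintro ⟨j, hj, rfl⟩
      refine ⟨⟨mul_dvd_mul_left _ (pow_dvd_pow q hj.le),
        (mul_pos hpos (pow_pos hq.pos b)).ne'⟩, fun h => ?_, fun h => hj.ne (hinj h),
        dvd_mul_right _ _⟩
      have h1 := Nat.eq_one_of_mul_eq_one_right h
      exact (Nat.one_lt_pow (by omega) hp.one_lt).ne' h1
  rw [heq, Finset.card_image_of_injective _ hinj, Finset.card_range]

section twoPrimes

variable {n p q a b : ℕ}

lemma card_vertices_add_two [NeZero n] (hp : p.Prime) (hq : q.Prime) (hpq : p ≠ q) (ha : 1 ≤ a)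
    (hn : n = p ^ a * q ^ b) :
    Nat.card (NonzeroProperIdeal (ZMod n)) + 2 = (a + 1) * (b + 1) := by
  classical
  let _ : Fintype (NonzeroProperIdeal (ZMod n)) := Fintype.ofFinite _
  have hn0 : n ≠ 0 := NeZero.ne n
  have hn1 : n ≠ 1 := fun h =>
    (Nat.one_lt_pow (by omega) hp.one_lt).ne' (Nat.eq_one_of_mul_eq_one_right (hn.symm.trans h))
  have hdiv : n.divisors.card = (a + 1) * (b + 1) := by
    rw [hn, Nat.Coprime.card_divisors_mul (Nat.coprime_pow_primes a b hp hq hpq)]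
    simp [Nat.divisors_prime_pow, hp, hq]
  have hfilter : (n.divisors.filter fun d => d ≠ 1 ∧ d ≠ n ∧ True) =
      (n.divisors.erase n).erase 1 := by
    ext d
    simp only [Finset.mem_filter, Finset.mem_erase]
    tauto
  have h1 : 1 ∈ n.divisors.erase n :=
    Finset.mem_erase.2 ⟨hn1.symm, Nat.one_mem_divisors.2 hn0⟩
  have hcard := card_filter_vertices (n := n) fun _ => True
  rw [Finset.filter_true, hfilter, Finset.card_univ, ← Nat.card_eq_fintype_card] at hcard
  rw [hcard, ← hdiv, ← Finset.card_erase_add_one (Nat.mem_divisors_self n hn0),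
    ← Finset.card_erase_add_one h1]

/-- The part of the vertex with divisor `d` in the complete multipartite graph for
`n = p ^ a * q ^ b`. The multiples of `p ^ a` and those of `q ^ b` form two parts, and every other
vertex is a part by itself. The labels `0` and `1` are free, as `d` is neither. -/
def multipartiteLabel (p q a b d : ℕ) : ℕ :=
  if p ^ a ∣ d then 0 else if q ^ b ∣ d then 1 else d

lemma essentialIdealGraph_adj_iff_label_ne [NeZero n] (hp : p.Prime) (hq : q.Prime) (hpq : p ≠ q)
    (ha : 1 ≤ a) (hb : 1 ≤ b) (hn : n = p ^ a * q ^ b) (I K : NonzeroProperIdeal (ZMod n)) :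
    (essentialIdealGraph (ZMod n)).Adj I K ↔
      multipartiteLabel p q a b (idealDivisor I.1) ≠
        multipartiteLabel p q a b (idealDivisor K.1) := by
  have hcop : Nat.Coprime (p ^ a) (q ^ b) := Nat.coprime_pow_primes a b hp hq hpq
  have hpn : p ∣ n := hn ▸ (dvd_pow_self p (by omega)).mul_right _
  have hqn : q ∣ n := hn ▸ (dvd_pow_self q (by omega)).mul_left _
  have hpq' : ¬ p ∣ q ^ b := fun h =>
    hpq ((Nat.prime_dvd_prime_iff_eq hp hq).1 (hp.dvd_of_dvd_pow h))
  have hqp' : ¬ q ∣ p ^ a := fun h =>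
    hpq ((Nat.prime_dvd_prime_iff_eq hq hp).1 (hq.dvd_of_dvd_pow h)).symm
  have hess : ∀ J : Ideal (ZMod n), IsEssentialIdeal J ↔
      ¬ p ^ a ∣ idealDivisor J ∧ ¬ q ^ b ∣ idealDivisor J := fun J => by
    have h1 : idealDivisor J ∣ n / p ↔ ¬ p ^ a ∣ idealDivisor J := by
      have := dvd_div_prime_iff_not_pow_dvd hp hpq' ((idealDivisor_dvd J).trans hn.dvd)
        (hpn.trans hn.dvd)
      rwa [← hn] at this
    have hn' : n = q ^ b * p ^ a := hn.trans (mul_comm _ _)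
    have h2 : idealDivisor J ∣ n / q ↔ ¬ q ^ b ∣ idealDivisor J := by
      have := dvd_div_prime_iff_not_pow_dvd hq hqp' ((idealDivisor_dvd J).trans hn'.dvd)
        (hqn.trans hn'.dvd)
      rwa [← hn'] at this
    rw [isEssentialIdeal_iff_dvd_div, ← h1, ← h2]
    constructor
    · exact fun h => ⟨h p hp hpn, h q hq hqn⟩
    · rintro ⟨hP, hQ⟩ l hl hln
      rcases hl.dvd_mul.1 (hln.trans hn.dvd) with h | h
      · rwa [(Nat.prime_dvd_prime_iff_eq hl hp).1 (hl.dvd_of_dvd_pow h)]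
      · rwa [(Nat.prime_dvd_prime_iff_eq hl hq).1 (hl.dvd_of_dvd_pow h)]
  have hboth : ∀ J : NonzeroProperIdeal (ZMod n),
      ¬ (p ^ a ∣ idealDivisor J.1 ∧ q ^ b ∣ idealDivisor J.1) := fun J h =>
    idealDivisor_ne_self J (Nat.dvd_antisymm (idealDivisor_dvd J.1)
      (hn.dvd.trans (hcop.mul_dvd_of_dvd_of_dvd h.1 h.2)))
  have hzero : ∀ J : NonzeroProperIdeal (ZMod n), idealDivisor J.1 ≠ 0 := fun J h =>
    NeZero.ne n (Nat.eq_zero_of_zero_dvd (h ▸ idealDivisor_dvd J.1))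
  change (I ≠ K ∧ IsEssentialIdeal (I.1 + K.1)) ↔ _
  rw [hess, idealDivisor_add, Nat.dvd_gcd_iff, Nat.dvd_gcd_iff, Ne, vertex_eq_iff]
  have hI := hboth I
  have hK := hboth K
  have hI0 := hzero I
  have hK0 := hzero K
  have hI1 := idealDivisor_ne_one I
  have hK1 := idealDivisor_ne_one K
  generalize idealDivisor I.1 = d at *
  generalize idealDivisor K.1 = e at *
  by_cases h : d = e
  · simp [h]
  unfold multipartiteLabel
  by_cases h1 : p ^ a ∣ d <;> by_cases h2 : p ^ a ∣ e <;> by_cases h3 : q ^ b ∣ d <;>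
    by_cases h4 : q ^ b ∣ e <;> simp_all [eq_comm]

/-- The essential ideal graph is complete multipartite with parts of sizes `b`, `a`, `1`, …, `1`;
here `b` is the largest size. -/
theorem connectivity_of_two_primes [NeZero n] (hp : p.Prime) (hq : q.Prime) (hpq : p ≠ q)
    (ha : 1 ≤ a) (hab : a ≤ b) (hb : 1 < b) (hn : n = p ^ a * q ^ b) :
    algebraicConnectivity (essentialIdealGraph (ZMod n)) =
        (Nat.card (NonzeroProperIdeal (ZMod n)) : ℝ) - b ∧
      vertexConnectivity (essentialIdealGraph (ZMod n)) + b =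
        Nat.card (NonzeroProperIdeal (ZMod n)) := by
  classical
  let _ : Fintype (NonzeroProperIdeal (ZMod n)) := Fintype.ofFinite _
  have hpos : 0 < p ^ a := pow_pos hp.pos a
  have hpa : 1 < p ^ a := Nat.one_lt_pow (by omega) hp.one_lt
  set f : NonzeroProperIdeal (ZMod n) → ℕ := fun I => multipartiteLabel p q a b (idealDivisor I.1)
    with hf
  have hG := essentialIdealGraph_adj_iff_label_ne hp hq hpq ha (by omega) hn
  have hcount : ∀ I : NonzeroProperIdeal (ZMod n), p ^ a ∣ idealDivisor I.1 →
      (Finset.univ.filter fun J => f J = f I).card = b := fun I hI => by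
    rw [← card_filter_pow_dvd_divisors (b := b) hp hq ha, ← hn, ← card_filter_vertices]
    congr 1
    refine Finset.filter_congr fun J _ => ?_
    have hJ0 : idealDivisor J.1 ≠ 0 := fun h =>
      NeZero.ne n (Nat.eq_zero_of_zero_dvd (h ▸ idealDivisor_dvd J.1))
    simp only [hf, multipartiteLabel, hI, if_true]
    split_ifs <;> simp_all
  have hM : ∀ I, (Finset.univ.filter fun J => f J = f I).card ≤ b := fun I => by
    by_cases hI : p ^ a ∣ idealDivisor I.1
    · exact (hcount I hI).le
    by_cases hI' : q ^ b ∣ idealDivisor I.1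
    · refine le_trans ?_ hab
      rw [← card_filter_pow_dvd_divisors (p := q) (a := b) (b := a) hq hp (by omega),
        mul_comm (q ^ b), ← hn, ← card_filter_vertices]
      refine Finset.card_le_card (Finset.monotone_filter_right _ fun J _ hJ => ?_)
      have hJ1 := idealDivisor_ne_one J
      simp only [hf, multipartiteLabel, hI, hI', if_true, if_false] at hJ
      split_ifs at hJ <;> simp_all
    · refine le_trans (Finset.card_le_one.2 fun J hJ K hK => ?_) hb.le
      have hI0 : idealDivisor I.1 ≠ 0 := fun h => hI (h ▸ dvd_zero _)
      have hI1 := idealDivisor_ne_one I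
      have key : ∀ J, f J = f I → J = I := fun J hJ => by
        rw [vertex_eq_iff]
        simp only [hf, multipartiteLabel, hI, hI', if_false] at hJ
        split_ifs at hJ
        exacts [absurd hJ.symm hI0, absurd hJ.symm hI1, hJ]
      rw [key J (Finset.mem_filter.1 hJ).2, key K (Finset.mem_filter.1 hK).2]
  -- two vertices in the largest part
  set u := vertexOfDivisor (n := n) (p ^ a) (hn ▸ dvd_mul_right _ _) hpa.ne'
    fun h => by
      have h1 : q ^ b = 1 := Nat.eq_of_mul_eq_mul_left hpos (by rw [← hn, mul_one, h])
      exact (Nat.one_lt_pow (by omega) hq.one_lt).ne' h1 with hu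
  set v := vertexOfDivisor (n := n) (p ^ a * q)
    (hn ▸ mul_dvd_mul_left _ (dvd_pow_self q (by omega)))
    (fun h => hpa.ne' (Nat.eq_one_of_mul_eq_one_right h))
    fun h => by
      have h1 : q ^ b = q ^ 1 := Nat.eq_of_mul_eq_mul_left hpos (by rw [← hn, pow_one, h])
      exact hb.ne' (Nat.pow_right_injective hq.two_le h1) with hv
  have hu' : idealDivisor u.1 = p ^ a := idealDivisor_vertexOfDivisor _ _ _
  have hv' : idealDivisor v.1 = p ^ a * q := idealDivisor_vertexOfDivisor _ _ _
  have huv : u ≠ v := fun h => by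
    rw [vertex_eq_iff, hu', hv'] at h
    exact hq.ne_one (Nat.eq_of_mul_eq_mul_left hpos (by rw [← h, mul_one]))
  have hfuv : f u = f v := by
    simp only [hf, multipartiteLabel, hu', hv', dvd_refl, dvd_mul_right, if_true]
  have hfu := hcount u hu'.symm.dvd
  rw [Nat.card_eq_fintype_card]
  exact ⟨algebraicConnectivity_of_adj_iff_ne (f := f) hG (by convert hM) huv hfuv (by convert hfu),
    vertexConnectivity_of_adj_iff_ne (f := f) hG (by convert hM) huv hfuv (by convert hfu)⟩

end twoPrimes

theorem mainTheorem11 (n : ℕ) [NeZero n] :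
    (∀ (k : ℕ) (p : Fin k → ℕ), 2 < k → (∀ i, (p i).Prime) → Function.Injective p →
      n = ∏ i, p i →
      algebraicConnectivity (essentialIdealGraph (ZMod n)) <
        (vertexConnectivity (essentialIdealGraph (ZMod n)) : ℝ)) ∧
    (∀ p₁ p₂ m₁ m₂ : ℕ, p₁.Prime → p₂.Prime → p₁ ≠ p₂ → 1 ≤ m₁ → 1 ≤ m₂ →
      (1 < m₁ ∨ 1 < m₂) → n = p₁ ^ m₁ * p₂ ^ m₂ →
      Nat.card (NonzeroProperIdeal (ZMod n)) + 2 = (m₁ + 1) * (m₂ + 1) ∧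
      algebraicConnectivity (essentialIdealGraph (ZMod n)) =
        (vertexConnectivity (essentialIdealGraph (ZMod n)) : ℝ) ∧
      (vertexConnectivity (essentialIdealGraph (ZMod n)) : ℝ) =
        (Nat.card (NonzeroProperIdeal (ZMod n)) : ℝ) - ((max m₁ m₂ : ℕ) : ℝ)) := by
  constructor
  · intro k p hk hp hinj hn
    have hne : ∀ {i j : Fin k}, i ≠ j → p i ≠ p j := fun h h' => h (hinj h')
    have hsq : Squarefree n := by
      rw [hn]
      refine Finset.squarefree_prod_of_pairwise_isCoprime ?_ fun i _ => (hp i).squarefree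
      intro i _ j _ hij
      exact Nat.coprime_iff_isRelPrime.1 ((Nat.coprime_primes (hp i) (hp j)).2 (hne hij))
    have h02 : (⟨0, by omega⟩ : Fin k) ≠ ⟨2, hk⟩ := by simp
    have h12 : (⟨1, by omega⟩ : Fin k) ≠ ⟨2, hk⟩ := by simp
    refine algebraicConnectivity_lt_vertexConnectivity_of_squarefree hsq (hp _) (hp _) (hp _)
      (hne h02) (hne h12) ?_
    have hprod : ∏ i ∈ {⟨0, by omega⟩, ⟨1, by omega⟩, ⟨2, hk⟩}, p i =
        p ⟨0, by omega⟩ * p ⟨1, by omega⟩ * p ⟨2, hk⟩ := by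
      rw [Finset.prod_insert (by simp), Finset.prod_insert (by simp), Finset.prod_singleton,
        mul_assoc]
    rw [hn, ← hprod]
    exact Finset.prod_dvd_prod_of_subset _ _ _ (Finset.subset_univ _)
  · intro p₁ p₂ m₁ m₂ hp₁ hp₂ hne h₁ h₂ hm hn
    refine ⟨card_vertices_add_two hp₁ hp₂ hne h₁ hn, ?_⟩
    have key : algebraicConnectivity (essentialIdealGraph (ZMod n)) =
          (Nat.card (NonzeroProperIdeal (ZMod n)) : ℝ) - (max m₁ m₂ : ℕ) ∧
        vertexConnectivity (essentialIdealGraph (ZMod n)) + max m₁ m₂ =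
          Nat.card (NonzeroProperIdeal (ZMod n)) := by
      rcases le_total m₁ m₂ with h | h
      · rw [max_eq_right h]
        exact connectivity_of_two_primes hp₁ hp₂ hne h₁ h (by omega) hn
      · rw [max_eq_left h]
        exact connectivity_of_two_primes hp₂ hp₁ hne.symm h₂ h (by omega)
          (hn.trans (mul_comm _ _))
    have hκ : (vertexConnectivity (essentialIdealGraph (ZMod n)) : ℝ) =
        (Nat.card (NonzeroProperIdeal (ZMod n)) : ℝ) - ((max m₁ m₂ : ℕ) : ℝ) := by
      rw [eq_sub_iff_add_eq]
      exact_mod_cast key.2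
    exact ⟨key.1.trans hκ.symm, hκ⟩
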